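/- Let $N\ge 1$ and let $\mathcal K^N$ be the class of convex bodies of $\mathbb R^N$, i.e. convex compact sets with nonempty interior. Write $|\cdot|$ for Lebesgue measure and, for $K\in\mathcal K^N$, let $P(K)=\mathcal H^{N-1}(\partial K)$ be its perimeter. Let $D\subset\mathbb R^N$ be any set and let $R:\mathcal K^N\to\mathbb R$ satisfy the one-sided inner Lipschitz condition with respect to volume: for every $K\in\mathcal K^N$ there exist $C_K>0$ and $\varepsilon_K>0$ such that $$R(\widetilde K)-R(K)\le C_K|K\setminus\widetilde K|\qquad\text{for all }\widetilde K\in\mathcal K^N\text{ with }\widetilde K\subset K,\ |K\setminus\widetilde K|\le\varepsilon_K .$$ Let $K^*$ be a solution of $\inf\{P(K)+R(K):\ K\in\mathcal K^N,\ K\subset D\}$, i.e. $K^*\in\mathcal K^N$, $K^*\subset D$ and $P(K^*)+R(K^*)\le P(K)+R(K)$ for all $K\in\mathcal K^N$ with $K\subset D$. Then: (1) $K^*$ is a quasi-minimizer of the perimeter under convexity constraint: there exist $\varepsilon>0$ and $\Lambda\ge0$ such that $P(K^*)\le P(\widetilde K)+\Lambda|K^*\setminus\widetilde K|$ for all $\widetilde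 K\in\mathcal K^N$ with $\widetilde K\subset K^*$ and $|K^*\setminus\widetilde K|\le\varepsilon$; (2) $K^*$ is of class $C^{1,1}$: near each point $x_0\in\partial K^*$ and in suitable orthonormal coordinates $(y,t)\in\mathbb R^{N-1}\times\mathbb R$ centred at $x_0$, $K^*$ coincides with the epigraph $\{t\ge u(y)\}$ of a function $u$ of class $C^1$ with Lipschitz gradient. -/

import Mathlib

open MeasureTheory
open scoped NNReal

/-- The class of convex bodies of `ℝ^N` in the sense of shape optimization: convex compact subsets
of `ℝ^N` with nonempty interior. -/
structure SolidConvexBody (N : ℕ) extends ConvexBody (EuclideanSpace ℝ (Fin N)) where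
  /-- The interior is nonempty. -/
  interior_nonempty' : (interior carrier).Nonempty

namespace SolidConvexBody

variable {N : ℕ}

/-- The perimeter `P(K)` of a convex body `K` of `ℝ^N`, `N ≥ 1`: the `(N-1)`-dimensional Hausdorff
measure of its boundary (normalized so as to agree with Lebesgue measure in dimension `N-1`). -/
noncomputable def perimeter (K : SolidConvexBody N) : ℝ :=
  (μHE[N - 1] : Measure (EuclideanSpace ℝ (Fin N))).real (frontier K.carrier)

/-- `|K \ K'|`, the Lebesgue measure of the set difference. -/
noncomputable def volDiff (K K' : SolidConvexBody N) : ℝ :=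
  (volume : Measure (EuclideanSpace ℝ (Fin N))).real (K.carrier \ K'.carrier)

/-- `K` is a quasi-minimizer of the perimeter under convexity constraint: for some `ε > 0`, `Λ ≥ 0`,
one has `P(K) ≤ P(K') + Λ |K \ K'|` for all convex bodies `K' ⊆ K` with `|K \ K'| ≤ ε`. -/
def IsQuasiMinimizer (K : SolidConvexBody N) : Prop :=
  ∃ ε > (0 : ℝ), ∃ Λ ≥ (0 : ℝ), ∀ K' : SolidConvexBody N,
    K'.carrier ⊆ K.carrier → volDiff K K' ≤ ε → perimeter K ≤ perimeter K' + Λ * volDiff K K'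

/-- The one-sided inner Lipschitz condition, with respect to volume, on a shape functional `R`
(the constants may depend on `K`). -/
def InnerLipschitz (R : SolidConvexBody N → ℝ) : Prop :=
  ∀ K : SolidConvexBody N, ∃ C > (0 : ℝ), ∃ ε > (0 : ℝ), ∀ K' : SolidConvexBody N,
    K'.carrier ⊆ K.carrier → volDiff K K' ≤ ε → R K' - R K ≤ C * volDiff K K'

/-- `K` is a solution of `inf { P(K) + R(K) : K convex body, K ⊆ D }`. -/
def IsMinimizer (R : SolidConvexBody N → ℝ) (D : Set (EuclideanSpace ℝ (Fin N)))
    (K : SolidConvexBody N) : Prop :=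
  K.carrier ⊆ D ∧ ∀ K' : SolidConvexBody N, K'.carrier ⊆ D →
    perimeter K + R K ≤ perimeter K' + R K'

end SolidConvexBody

/-- A real function `u` is of class `C^{1,1}` on an open set `U`: it is `C^1` on `U` and its
differential is Lipschitz on `U`. -/
def IsC11On {F : Type*} [NormedAddCommGroup F] [NormedSpace ℝ F] (u : F → ℝ) (U : Set F) : Prop :=
  ContDiffOn ℝ 1 u U ∧ ∃ L : ℝ≥0, LipschitzOnWith L (fderiv ℝ u) U

/-- A subset `K` of a Euclidean space is (a closed domain) of class `C^{1,1}`: near every boundary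
point `x₀`, in the orthogonal coordinates `(y, t) ↦ x₀ + y + t ξ` given by some unit vector `ξ` and
the hyperplane `ξᗮ`, the set `K` is the epigraph `{u(y) ≤ t}` of a `C^{1,1}` function `u`. -/
def IsC11Set {E : Type*} [NormedAddCommGroup E] [InnerProductSpace ℝ E] (K : Set E) : Prop :=
  ∀ x₀ ∈ frontier K, ∃ ξ : E, ‖ξ‖ = 1 ∧ ∃ r > (0 : ℝ), ∃ u : (Submodule.span ℝ {ξ})ᗮ → ℝ,
    IsC11On u (Metric.ball 0 r) ∧
      ∀ y ∈ Metric.ball (0 : (Submodule.span ℝ {ξ})ᗮ) r, ∀ t : ℝ, |t| < r →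
        (x₀ + (y : E) + t • ξ ∈ K ↔ u y ≤ t)

/-! Comparing a minimizer with bodies inside it bounds the perimeter lost by a multiple of the
volume lost. Only such competitors are needed, and the ones used are halfspace cuts.

Let `n` and `m` be outer unit normals at points at distance at most `δ`, and put `D = ‖n - m‖`.
Cutting orthogonally to `n + m` at a suitable level removes a cap of depth at least `D δ / 2` whose
width along `n - m` is at most `4 δ`. If the normals turned too fast, this cap would be deep for its
width, and removing it would save too much perimeter. Quantitatively, let `s` be the area of the
cutting section, `V` the volume of the cap and `W` the area of a slice of the cap orthogonal to `n -
m`. Projecting the boundary of the cap along a direction tilted by a slope of order `σ` shows that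
its area is at least `√(1 - σ²) s + σ W` (`le_euclideanHausdorffMeasure_frontier_cap`).
Quasi-minimality then gives `σ W ≤ σ² s + Λ V`. A cone inside the cap bounds `s` by `V / depth`
(`volume_cap_ge`), and averaging over slices bounds `W` below by `V / width` (`exists_slice_ge`),
each up to a constant. Optimizing `σ` gives depth `≲ Λ width²` (`cap_depth_le`), that is, `D ≲ Λ δ`:
the normal is Lipschitz.

Near a boundary point the body is the epigraph of a convex function, and its normals supply a
Lipschitz selection of subgradients. Such a selection is necessarily the gradient, so the function
is `C^{1,1}`. -/

open Module Set
open scoped InnerProductSpace ENNReal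

/-! ### Areas of hyperplane slices and of their projections. -/

section EuclideanHausdorff

theorem LipschitzOnWith.euclideanHausdorffMeasure_image_le {X Y : Type*} [MetricSpace X]
    [MeasurableSpace X] [BorelSpace X] [MetricSpace Y] [MeasurableSpace Y] [BorelSpace Y]
    {f : X → Y} {s : Set X} (hf : LipschitzOnWith 1 f s) (d : ℕ) :
    μHE[d] (f '' s) ≤ μHE[d] s := by
  simp_rw [Measure.euclideanHausdorffMeasure_def, Measure.smul_apply]
  gcongr
  simpa using hf.hausdorffMeasure_image_le (Nat.cast_nonneg d)

variable {E : Type*} [NormedAddCommGroup E] [InnerProductSpace ℝ E]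

theorem slice_eq_image {n : E} (hn : ‖n‖ = 1) {h : ℝ} {A : Set E} (hA : A ⊆ {x | ⟪n, x⟫_ℝ = h}) :
    A = (fun y : (ℝ ∙ n)ᗮ => h • n + (y : E)) '' {y | h • n + (y : E) ∈ A} := by
  ext x
  constructor
  · intro hx
    have hx' : ⟪n, x⟫_ℝ = h := hA hx
    refine ⟨⟨x - h • n, ?_⟩, ?_, ?_⟩
    · rw [Submodule.mem_orthogonal_singleton_iff_inner_right, inner_sub_right, inner_smul_right,
        real_inner_self_eq_norm_sq, hn, hx']
      ring
    · simpa using hx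
    · simp
  · rintro ⟨y, hy, rfl⟩
    exact hy

theorem lipschitzWith_sub_inner_smul {m : E} (hm : ‖m‖ = 1) :
    LipschitzWith 1 (fun x => x - ⟪m, x⟫_ℝ • m) := by
  refine LipschitzWith.of_dist_le_mul fun x y => ?_
  rw [NNReal.coe_one, one_mul, dist_eq_norm, dist_eq_norm]
  have h : x - ⟪m, x⟫_ℝ • m - (y - ⟪m, y⟫_ℝ • m) = (x - y) - ⟪m, x - y⟫_ℝ • m := by
    rw [inner_sub_right, sub_smul]; abel
  rw [h]
  refine le_of_sq_le_sq ?_ (norm_nonneg _)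
  rw [@norm_sub_sq_real, inner_smul_right, real_inner_comm, norm_smul, hm, mul_one, Real.norm_eq_abs,
    sq_abs]
  nlinarith [sq_nonneg ⟪m, x - y⟫_ℝ]

variable [FiniteDimensional ℝ E]

theorem finrank_orthogonal_span_singleton' {n : E} (hn : n ≠ 0) :
    finrank ℝ (ℝ ∙ n)ᗮ = finrank ℝ E - 1 := by
  rw [← (ℝ ∙ n).finrank_add_finrank_orthogonal, finrank_span_singleton hn, Nat.add_sub_cancel_left]

variable [MeasurableSpace E] [BorelSpace E]

/-- Cavalieri's principle: the volume is the integral of the areas of the slices orthogonal to a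
unit vector. -/
theorem volume_eq_lintegral_slice {v : E} (hv : ‖v‖ = 1) {t : Set E} (ht : MeasurableSet t) :
    volume t = ∫⁻ c : ℝ, μHE[finrank ℝ E - 1] (t ∩ {x | ⟪v, x⟫_ℝ = c}) := by
  have hv0 : v ≠ 0 := by rintro rfl; simp at hv
  have hE : ‖v‖ₑ = 1 := by rw [← ofReal_norm, hv]; simp
  rw [← InnerProductSpace.euclideanHausdorffMeasure_eq_volume,
    EuclideanGeometry.euclideanHausdorffMeasure_eq_lintegral (0 : E) hv0 ht, hE, one_mul]
  congr with c
  congr 2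
  ext x
  simp only [vadd_eq_add, add_zero, SetLike.mem_coe, AffineSubspace.mem_mk', vsub_eq_sub,
    Submodule.mem_orthogonal_singleton_iff_inner_right, inner_sub_right, inner_smul_right,
    real_inner_self_eq_norm_sq, hv, mem_ofPred_eq]
  constructor <;> intro h <;> linarith

theorem euclideanHausdorffMeasure_slice_eq {n : E} (hn : ‖n‖ = 1) {h : ℝ} {A : Set E}
    (hA : A ⊆ {x | ⟪n, x⟫_ℝ = h}) :
    μHE[finrank ℝ E - 1] A = volume {y : (ℝ ∙ n)ᗮ | h • n + (y : E) ∈ A} := by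
  have hn0 : n ≠ 0 := by rintro rfl; simp at hn
  have hiso : Isometry (fun y : (ℝ ∙ n)ᗮ => h • n + (y : E)) :=
    (IsometryEquiv.addLeft (h • n)).isometry.comp isometry_subtype_coe
  conv_lhs => rw [slice_eq_image hn hA, hiso.euclideanHausdorffMeasure_image]
  rw [← finrank_orthogonal_span_singleton' hn0,
    InnerProductSpace.euclideanHausdorffMeasure_eq_volume]

theorem euclideanHausdorffMeasure_slice_lt_top {n : E} (hn : ‖n‖ = 1) {h : ℝ} {A : Set E}
    (hA : A ⊆ {x | ⟪n, x⟫_ℝ = h}) (hb : Bornology.IsBounded A) :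
    μHE[finrank ℝ E - 1] A < ⊤ := by
  rw [euclideanHausdorffMeasure_slice_eq hn hA]
  have hiso : Isometry (fun y : (ℝ ∙ n)ᗮ => h • n + (y : E)) :=
    (IsometryEquiv.addLeft (h • n)).isometry.comp isometry_subtype_coe
  exact (hiso.antilipschitz.isBounded_preimage hb).measure_lt_top

/-- The orthogonal projection, along a unit vector `m`, of a subset of a hyperplane with unit normal
`n`, has its area scaled by `⟪n, m⟫`. -/
theorem euclideanHausdorffMeasure_image_sub_inner_smul {n m : E} (hn : ‖n‖ = 1) (hm : ‖m‖ = 1)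
    (hnm : 0 ≤ ⟪n, m⟫_ℝ) {h : ℝ} {A : Set E} (hA : A ⊆ {x | ⟪n, x⟫_ℝ = h}) :
    μHE[finrank ℝ E - 1] ((fun x => x - ⟪m, x⟫_ℝ • m) '' A) =
      ENNReal.ofReal ⟪n, m⟫_ℝ * μHE[finrank ℝ E - 1] A := by
  have hn0 : n ≠ 0 := by rintro rfl; simp at hn
  let P : E →ₗ[ℝ] E := LinearMap.id - (innerₛₗ ℝ m).smulRight m
  have hP (x : E) : P x = x - ⟪m, x⟫_ℝ • m := by simp [P]
  let f : (ℝ ∙ n)ᗮ →ₗ[ℝ] E := P ∘ₗ (ℝ ∙ n)ᗮ.subtype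
  have hf (y : (ℝ ∙ n)ᗮ) : f y = (y : E) - ⟪m, (y : E)⟫_ℝ • m := hP y
  have hw : m - ⟪n, m⟫_ℝ • n ∈ (ℝ ∙ n)ᗮ := by
    rw [Submodule.mem_orthogonal_singleton_iff_inner_right, inner_sub_right, inner_smul_right,
      real_inner_self_eq_norm_sq, hn]
    ring
  let w : (ℝ ∙ n)ᗮ := ⟨m - ⟪n, m⟫_ℝ • n, hw⟩
  have hwy (y : (ℝ ∙ n)ᗮ) : ⟪w, y⟫_ℝ = ⟪m, (y : E)⟫_ℝ := by
    have := Submodule.mem_orthogonal_singleton_iff_inner_right.1 y.2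
    rw [Submodule.coe_inner, inner_sub_left, inner_smul_left, this]
    simp
  -- With `w` the component of `m` orthogonal to `n`, the Gram operator is `1 - w ⊗ w`, of
  -- determinant `1 - ‖w‖² = ⟪n, m⟫²`; its square root is the Jacobian.
  have hff : f.adjoint ∘ₗ f = LinearMap.transvection (-(innerₛₗ ℝ w)) w := by
    ext1 y
    refine ext_inner_right ℝ fun z => ?_
    rw [LinearMap.comp_apply, LinearMap.adjoint_inner_left, hf, hf]
    simp only [LinearMap.transvection.apply, LinearMap.neg_apply, innerₛₗ_apply_apply,
      inner_sub_left, inner_sub_right, inner_smul_left, inner_smul_right,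
      real_inner_self_eq_norm_sq, hm, inner_add_left, hwy, neg_smul, inner_neg_left]
    rw [real_inner_comm m (y : E), Submodule.coe_inner]
    simp
    ring
  have hdet : f.normDet = ⟪n, m⟫_ℝ := by
    have h1 := f.normDet_sq
    rw [hff, LinearMap.transvection.det] at h1
    simp only [LinearMap.neg_apply, innerₛₗ_apply_apply, hwy] at h1
    have h2 : ⟪m, (w : E)⟫_ℝ = 1 - ⟪n, m⟫_ℝ ^ 2 := by
      simp only [w, inner_sub_right, inner_smul_right, real_inner_self_eq_norm_sq, hm]
      rw [real_inner_comm]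
      ring
    rw [h2] at h1
    have h3 : f.normDet ^ 2 = ⟪n, m⟫_ℝ ^ 2 := by
      have h4 : ((f.normDet ^ 2 : ℝ) : ℝ) = 1 + -(1 - ⟪n, m⟫_ℝ ^ 2) := h1
      linarith
    exact (sq_eq_sq₀ f.normDet_nonneg hnm).1 h3
  rw [euclideanHausdorffMeasure_slice_eq hn hA]
  have himg : (fun x => x - ⟪m, x⟫_ℝ • m) '' A =
      (fun x => P (h • n) + x) '' (f '' {y : (ℝ ∙ n)ᗮ | h • n + (y : E) ∈ A}) := by
    conv_lhs => rw [slice_eq_image hn hA]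
    rw [image_image, image_image]
    refine image_congr fun y _ => ?_
    rw [← hP, map_add]
    rfl
  have hiso : Isometry (fun x => P (h • n) + x) := (IsometryEquiv.addLeft _).isometry
  rw [himg, hiso.euclideanHausdorffMeasure_image, ← finrank_orthogonal_span_singleton' hn0,
    LinearMap.euclideanHausdorffMeasure_image_eq_normDet_mul_volume, hdet]

end EuclideanHausdorff

/-! ### Boundary area and volume of convex bodies and their caps. -/

section ConvexGeometry

variable {E : Type*} [NormedAddCommGroup E] [InnerProductSpace ℝ E]

/-- The last point of the ray in `K` is a boundary point. Hence the projection of the frontier along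
`m` covers that of all of `K`, which is how boundary areas are bounded below. -/
theorem exists_add_smul_mem_frontier {K : Set E} (hK : IsCompact K) {p : E} (hp : p ∈ K) {m : E}
    (hm : m ≠ 0) : ∃ t : ℝ, 0 ≤ t ∧ p + t • m ∈ frontier K := by
  have hemb : Topology.IsClosedEmbedding (fun t : ℝ => p + t • m) :=
    (Homeomorph.addLeft p).isClosedEmbedding.comp (isClosedEmbedding_smul_left hm)
  have hT : IsCompact (Ici (0 : ℝ) ∩ (fun t : ℝ => p + t • m) ⁻¹' K) :=
    (hemb.isCompact_preimage hK).inter_left isClosed_Ici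
  obtain ⟨t, ⟨ht0, htK⟩, htmax⟩ := hT.exists_isGreatest ⟨0, by simpa using hp⟩
  refine ⟨t, ht0, ?_⟩
  rw [hK.isClosed.frontier_eq]
  refine ⟨htK, fun hint => ?_⟩
  have hnear : ∀ᶠ s in nhds t, p + s • m ∈ K :=
    hemb.continuous.continuousAt.preimage_mem_nhds (mem_interior_iff_mem_nhds.1 hint)
  obtain ⟨s, hs, hst⟩ := (hnear.filter_mono nhdsWithin_le_nhds |>.and
    (self_mem_nhdsWithin : Ioi t ∈ nhdsWithin t (Ioi t))).exists
  have : s ≤ t := htmax ⟨le_trans ht0 (le_of_lt hst), hs⟩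
  exact absurd this (not_le.2 hst)

theorem Convex.exists_unit_normal [CompleteSpace E] {K : Set E} (hK : Convex ℝ K)
    (hint : (interior K).Nonempty) {x : E} (hx : x ∉ interior K) :
    ∃ n : E, ‖n‖ = 1 ∧ ∀ p ∈ K, ⟪n, p⟫_ℝ ≤ ⟪n, x⟫_ℝ := by
  obtain ⟨f, hf0, hf⟩ := geometric_hahn_banach_of_nonempty_interior_point hK hx hint
  let v := (InnerProductSpace.toDual ℝ E).symm f
  have hv (y : E) : ⟪v, y⟫_ℝ = f y := InnerProductSpace.toDual_symm_apply
  have hv0 : v ≠ 0 := by simpa [v] using hf0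
  refine ⟨‖v‖⁻¹ • v, norm_smul_inv_norm hv0, fun p hp => ?_⟩
  rw [inner_smul_left, inner_smul_left, hv, hv]
  exact mul_le_mul_of_nonneg_left (hf p hp) (by simp)

theorem inner_add_radius_le {K : Set E} {a x n : E} {ρ : ℝ} (hn : ‖n‖ = 1)
    (hρ : 0 ≤ ρ) (hball : Metric.closedBall a ρ ⊆ K) (hx : ∀ p ∈ K, ⟪n, p⟫_ℝ ≤ ⟪n, x⟫_ℝ) :
    ⟪n, a⟫_ℝ + ρ ≤ ⟪n, x⟫_ℝ := by
  have := hx (a + ρ • n) (hball (by simp [norm_smul, hn, abs_of_nonneg hρ]))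
  rwa [inner_add_right, inner_smul_right, real_inner_self_eq_norm_sq, hn, one_pow, mul_one] at this

/-- Pushing two points of a convex set along outward normals does not bring them closer: the cross
terms in the inner product with `x - y` are nonnegative. -/
theorem norm_sub_le_norm_add_sub_add {x y v w : E} (hv : 0 ≤ ⟪v, x - y⟫_ℝ)
    (hw : 0 ≤ ⟪w, y - x⟫_ℝ) : ‖x - y‖ ≤ ‖x + v - (y + w)‖ := by
  have h1 : ‖x - y‖ * ‖x - y‖ ≤ ‖x - y‖ * ‖x + v - (y + w)‖ := by
    refine le_trans ?_ (real_inner_le_norm _ _)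
    have : x + v - (y + w) = (x - y) + (v - w) := by abel
    rw [this, inner_add_right, real_inner_self_eq_norm_mul_norm, inner_sub_right,
      real_inner_comm v, real_inner_comm w]
    have : ⟪w, x - y⟫_ℝ = -⟪w, y - x⟫_ℝ := by rw [← inner_neg_right, neg_sub]
    linarith
  rcases (norm_nonneg (x - y)).eq_or_lt with h0 | h0
  · rw [← h0]; exact norm_nonneg _
  · exact le_of_mul_le_mul_left h1 h0

variable [FiniteDimensional ℝ E] [MeasurableSpace E] [BorelSpace E]

/-- The boundary of a convex body is a contraction of the boundary of a circumscribed cube, hence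
has finite area. -/
theorem euclideanHausdorffMeasure_frontier_lt_top {K : Set E} (hK : Convex ℝ K)
    (hKc : IsCompact K) (hint : (interior K).Nonempty) :
    μHE[finrank ℝ E - 1] (frontier K) < ⊤ := by
  let b := stdOrthonormalBasis ℝ E
  obtain ⟨R, hR⟩ := hKc.isBounded.subset_closedBall (0 : E)
  let Q : Set E := ⋂ i, {x | |⟪b i, x⟫_ℝ| ≤ R}
  have hQcl : IsClosed Q := isClosed_iInter fun i =>
    isClosed_le (by fun_prop) continuous_const
  have hKQ : K ⊆ Q := fun x hx => mem_iInter.2 fun i => by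
    have h1 := abs_real_inner_le_norm (b i) x
    rw [b.orthonormal.1 i, one_mul] at h1
    exact h1.trans (by simpa using hR hx)
  have hQb : Bornology.IsBounded Q := by
    refine Metric.isBounded_closedBall (x := (0 : E)) (r := √(∑ _i : Fin (finrank ℝ E), R ^ 2))
      |>.subset fun x hx => ?_
    rw [mem_closedBall_zero_iff]
    apply Real.le_sqrt_of_sq_le
    rw [← b.sum_sq_norm_inner_right x]
    refine Finset.sum_le_sum fun i _ => ?_
    rw [Real.norm_eq_abs]
    have := mem_iInter.1 hx i
    exact pow_le_pow_left₀ (abs_nonneg _) this 2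
  have hQ : IsCompact Q := Metric.isCompact_of_isClosed_isBounded hQcl hQb
  have hfr : frontier Q ⊆ ⋃ i, (Q ∩ {x | ⟪b i, x⟫_ℝ = R}) ∪ (Q ∩ {x | ⟪b i, x⟫_ℝ = -R}) := by
    intro x hx
    rw [hQcl.frontier_eq] at hx
    by_contra hcon
    refine hx.2 (mem_interior.2 ⟨⋂ i, {x | |⟪b i, x⟫_ℝ| < R}, ?_, ?_, ?_⟩)
    · exact iInter_mono fun i y (hy : |⟪b i, y⟫_ℝ| < R) => hy.le
    · exact isOpen_iInter_of_finite fun i => isOpen_lt (by fun_prop) continuous_const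
    · refine mem_iInter.2 fun i =>
        lt_of_le_of_ne (b := R) (mem_iInter.1 hx.1 i) fun heq => hcon ?_
      refine mem_iUnion.2 ⟨i, ?_⟩
      rcases eq_or_eq_neg_of_abs_eq heq with h | h
      · exact Or.inl ⟨hx.1, h⟩
      · exact Or.inr ⟨hx.1, h⟩
  have hfin : μHE[finrank ℝ E - 1] (frontier Q) < ⊤ := by
    refine (measure_mono hfr).trans_lt <| (measure_iUnion_le _).trans_lt ?_
    rw [tsum_fintype]
    refine ENNReal.sum_lt_top.2 fun i _ => (measure_union_le _ _).trans_lt ?_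
    exact ENNReal.add_lt_top.2
      ⟨euclideanHausdorffMeasure_slice_lt_top (b.orthonormal.1 i) inter_subset_right
        (hQb.subset inter_subset_left),
      euclideanHausdorffMeasure_slice_lt_top (b.orthonormal.1 i) inter_subset_right
        (hQb.subset inter_subset_left)⟩
  have hfK : frontier K ⊆ K := hKc.isClosed.frontier_subset
  -- Following an outward normal at `x` until it leaves the cube defines an expanding map into the
  -- boundary of the cube; its inverse is the contraction.
  have hex (x : frontier K) :
      ∃ v : E, (∀ p ∈ K, ⟪v, p⟫_ℝ ≤ ⟪v, x⟫_ℝ) ∧ (x : E) + v ∈ frontier Q := by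
    obtain ⟨n, hn, hnK⟩ := hK.exists_unit_normal hint x.2.2
    obtain ⟨t, ht, hmem⟩ := exists_add_smul_mem_frontier hQ (hKQ (hfK x.2))
      (m := n) (by rintro rfl; simp at hn)
    refine ⟨t • n, fun p hp => ?_, hmem⟩
    rw [inner_smul_left, inner_smul_left]
    exact mul_le_mul_of_nonneg_left (hnK p hp) (by simpa using ht)
  choose v hvK hvQ using hex
  have hanti : AntilipschitzWith 1 (fun x : frontier K => (x : E) + v x) := by
    refine AntilipschitzWith.of_le_mul_dist fun x y => ?_
    rw [Subtype.dist_eq, dist_eq_norm, dist_eq_norm, NNReal.coe_one, one_mul]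
    apply norm_sub_le_norm_add_sub_add
    · rw [inner_sub_right]
      linarith [hvK x y (hfK y.2)]
    · rw [inner_sub_right]
      linarith [hvK y x (hfK x.2)]
  have hle : μHE[finrank ℝ E - 1] (univ : Set (frontier K)) ≤
      μHE[finrank ℝ E - 1] ((fun x : frontier K => (x : E) + v x) '' univ) := by
    simp_rw [Measure.euclideanHausdorffMeasure_def, Measure.smul_apply]
    gcongr
    simpa using hanti.le_hausdorffMeasure_image (Nat.cast_nonneg (finrank ℝ E - 1)) univ
  have hval : (frontier K) = ((↑) : frontier K → E) '' univ := by simp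
  conv_lhs => rw [hval]
  rw [isometry_subtype_coe.euclideanHausdorffMeasure_image]
  refine hle.trans_lt ((measure_mono ?_).trans_lt hfin)
  rintro _ ⟨x, -, rfl⟩
  exact hvQ x

/-- Lower bound on the area of the part of the boundary of a compact set lying above the hyperplane
`⟪n, x⟫ = h`, in terms of the area of the section by this hyperplane and of that of a section of the
cap by an orthogonal hyperplane. -/
theorem le_euclideanHausdorffMeasure_frontier_cap {K : Set E} (hK : IsCompact K) {n e : E}
    (hn : ‖n‖ = 1) (he : ‖e‖ = 1) (hne : ⟪n, e⟫_ℝ = 0) {α σ : ℝ} (hα : 0 < α) (hσ : 0 < σ)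
    (hασ : α ^ 2 + σ ^ 2 = 1) (h c : ℝ) :
    ENNReal.ofReal α * μHE[finrank ℝ E - 1] (K ∩ {x | ⟪n, x⟫_ℝ = h}) +
      ENNReal.ofReal σ * μHE[finrank ℝ E - 1] (K ∩ {x | h < ⟪n, x⟫_ℝ} ∩ {x | ⟪e, x⟫_ℝ = c}) ≤
      μHE[finrank ℝ E - 1] (frontier K ∩ {x | h ≤ ⟪n, x⟫_ℝ}) := by
  set μ : Measure E := μHE[finrank ℝ E - 1]
  have hen : ⟪e, n⟫_ℝ = 0 := by rwa [real_inner_comm]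
  have hnn : ⟪n, n⟫_ℝ = 1 := by rw [real_inner_self_eq_norm_sq, hn, one_pow]
  have hee : ⟪e, e⟫_ℝ = 1 := by rw [real_inner_self_eq_norm_sq, he, one_pow]
  -- The tilted direction: it rises above the section, so rays stay in the cap's halfspace, and it
  -- decreases `⟪e, ·⟫`, so rays stay in `⟪e, x⟫ ≤ c`.
  let m : E := α • n - σ • e
  have hnm : ⟪n, m⟫_ℝ = α := by simp [m, inner_sub_right, inner_smul_right, hn, hne]
  have hem : ⟪e, m⟫_ℝ = -σ := by simp [m, inner_sub_right, inner_smul_right, he, hen]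
  have hm : ‖m‖ = 1 := by
    have : ‖m‖ ^ 2 = 1 := by
      rw [← real_inner_self_eq_norm_sq]
      nth_rewrite 1 [show m = α • n - σ • e from rfl]
      rw [inner_sub_left, inner_smul_left, inner_smul_left, hnm, hem]
      simp only [conj_trivial]
      linarith
    exact (pow_eq_one_iff_of_nonneg (norm_nonneg m) two_ne_zero).1 this
  have hn0 : n ≠ 0 := by rintro rfl; simp at hn
  have hm0 : m ≠ 0 := by intro h0; simp [h0] at hm
  have hmeas_le : MeasurableSet {x : E | ⟪e, x⟫_ℝ ≤ c} :=
    (isClosed_le (by fun_prop) continuous_const).measurableSet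
  let proj (v x : E) : E := x - ⟪v, x⟫_ℝ • v
  have hproj (v x : E) (hv : ‖v‖ = 1) (t : ℝ) : proj v (x + t • v) = proj v x := by
    simp only [proj, inner_add_right, inner_smul_right, real_inner_self_eq_norm_sq, hv]
    module
  let S : Set E := K ∩ {x | ⟪n, x⟫_ℝ = h}
  let W : Set E := K ∩ {x | h < ⟪n, x⟫_ℝ} ∩ {x | ⟪e, x⟫_ℝ = c}
  let G : Set E := frontier K ∩ {x | h ≤ ⟪n, x⟫_ℝ}
  change ENNReal.ofReal α * μ S + ENNReal.ofReal σ * μ W ≤ μ G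
  -- the part `⟪e, x⟫ > c` is projected along `n`
  have hright : ENNReal.ofReal α * μ (S \ {x | ⟪e, x⟫_ℝ ≤ c}) ≤ μ (G \ {x | ⟪e, x⟫_ℝ ≤ c}) := by
    have hα1 : ENNReal.ofReal α ≤ 1 := by
      rw [← ENNReal.ofReal_one]
      exact ENNReal.ofReal_le_ofReal (by nlinarith)
    have harea : μ (proj n '' (S \ {x | ⟪e, x⟫_ℝ ≤ c})) = μ (S \ {x | ⟪e, x⟫_ℝ ≤ c}) := by
      have := euclideanHausdorffMeasure_image_sub_inner_smul hn hn (by rw [hnn]; exact zero_le_one)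
        (h := h) (A := S \ {x | ⟪e, x⟫_ℝ ≤ c}) (fun x hx => hx.1.2)
      rwa [hnn, ENNReal.ofReal_one, one_mul] at this
    calc ENNReal.ofReal α * μ (S \ {x | ⟪e, x⟫_ℝ ≤ c})
        ≤ 1 * μ (S \ {x | ⟪e, x⟫_ℝ ≤ c}) := by gcongr
      _ = μ (proj n '' (S \ {x | ⟪e, x⟫_ℝ ≤ c})) := by rw [one_mul, harea]
      _ ≤ μ (proj n '' (G \ {x | ⟪e, x⟫_ℝ ≤ c})) := by
        refine measure_mono ?_
        rintro _ ⟨p, ⟨⟨hpK, hpn⟩, hpe⟩, rfl⟩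
        obtain ⟨t, ht, hfr⟩ := exists_add_smul_mem_frontier hK hpK hn0
        refine ⟨p + t • n, ⟨⟨hfr, ?_⟩, ?_⟩, hproj n p hn t⟩
        · simp only [mem_ofPred_eq] at hpn ⊢
          rw [inner_add_right, inner_smul_right, hnn, hpn]
          linarith
        · simp only [mem_ofPred_eq] at hpe ⊢
          rwa [inner_add_right, inner_smul_right, hen, mul_zero, add_zero]
      _ ≤ _ := ((lipschitzWith_sub_inner_smul hn).lipschitzOnWith
          (s := _)).euclideanHausdorffMeasure_image_le _
  -- the part `⟪e, x⟫ ≤ c` is projected along `m`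
  have hleft : ENNReal.ofReal α * μ (S ∩ {x | ⟪e, x⟫_ℝ ≤ c}) + ENNReal.ofReal σ * μ W ≤
      μ (G ∩ {x | ⟪e, x⟫_ℝ ≤ c}) := by
    have hS : μ (proj m '' (S ∩ {x | ⟪e, x⟫_ℝ ≤ c})) =
        ENNReal.ofReal α * μ (S ∩ {x | ⟪e, x⟫_ℝ ≤ c}) := by
      have := euclideanHausdorffMeasure_image_sub_inner_smul hn hm (by rw [hnm]; exact hα.le)
        (h := h) (A := S ∩ {x | ⟪e, x⟫_ℝ ≤ c}) (fun x hx => hx.1.2)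
      rwa [hnm] at this
    have hW : μ (proj m '' W) = ENNReal.ofReal σ * μ W := by
      have hem' : ⟪-e, m⟫_ℝ = σ := by rw [inner_neg_left, hem, neg_neg]
      have := euclideanHausdorffMeasure_image_sub_inner_smul (n := -e) (m := m) (by simpa using he)
        hm (by rw [hem']; exact hσ.le) (h := -c) (A := W)
        (fun x hx => by simpa [inner_neg_left] using hx.2)
      rwa [hem'] at this
    -- If `w = p + t m`, the `n`-coordinates force `t > 0`, so the `e`-coordinate falls strictly
    -- below `c`, contradicting `w ∈ W`.
    have hdisj : Disjoint (proj m '' (S ∩ {x | ⟪e, x⟫_ℝ ≤ c})) (proj m '' W) := by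
      rw [disjoint_left]
      rintro _ ⟨p, ⟨⟨-, hpn⟩, hpe⟩, rfl⟩ ⟨w, ⟨⟨-, hwn⟩, hwe⟩, hwp⟩
      simp only [mem_ofPred_eq] at hpn hpe hwn hwe
      simp only [proj] at hwp
      have hw : w = p + (⟪m, w⟫_ℝ - ⟪m, p⟫_ℝ) • m := by
        rw [sub_smul, ← sub_eq_zero]
        rw [← sub_eq_zero] at hwp
        rw [← hwp]; abel
      have h1 := congrArg (fun x => ⟪n, x⟫_ℝ) hw
      have h2 := congrArg (fun x => ⟪e, x⟫_ℝ) hw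
      simp only [inner_add_right, inner_smul_right, hnm, hem] at h1 h2
      have h3 : 0 < ⟪m, w⟫_ℝ - ⟪m, p⟫_ℝ := by
        by_contra hcon
        nlinarith
      nlinarith
    have hSm : MeasurableSet (proj m '' (S ∩ {x | ⟪e, x⟫_ℝ ≤ c})) := by
      refine IsCompact.measurableSet (IsCompact.image ?_ (by fun_prop))
      exact (hK.inter_right (isClosed_eq (by fun_prop) continuous_const)).inter_right
        (isClosed_le (by fun_prop) continuous_const)
    rw [← hS, ← hW, ← measure_union' hdisj hSm]
    refine le_trans (measure_mono ?_) <|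
      ((lipschitzWith_sub_inner_smul hm).lipschitzOnWith (s := _)).euclideanHausdorffMeasure_image_le
        _
    have key {p : E} (hpK : p ∈ K) (hpn : h ≤ ⟪n, p⟫_ℝ) (hpe : ⟪e, p⟫_ℝ ≤ c) :
        proj m p ∈ proj m '' (G ∩ {x | ⟪e, x⟫_ℝ ≤ c}) := by
      obtain ⟨t, ht, hfr⟩ := exists_add_smul_mem_frontier hK hpK hm0
      refine ⟨p + t • m, ⟨⟨hfr, ?_⟩, ?_⟩, hproj m p hm t⟩
      · simp only [mem_ofPred_eq]
        rw [inner_add_right, inner_smul_right, hnm]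
        nlinarith
      · simp only [mem_ofPred_eq]
        rw [inner_add_right, inner_smul_right, hem]
        nlinarith
    rintro _ (⟨p, ⟨⟨hpK, hpn⟩, hpe⟩, rfl⟩ | ⟨p, ⟨⟨hpK, hpn⟩, hpe⟩, rfl⟩)
    · exact key hpK (ge_of_eq hpn) hpe
    · exact key hpK (le_of_lt hpn) (le_of_eq hpe)
  rw [← measure_inter_add_sdiff G hmeas_le, ← measure_inter_add_sdiff S hmeas_le, mul_add]
  calc _ = (ENNReal.ofReal α * μ (S ∩ {x | ⟪e, x⟫_ℝ ≤ c}) + ENNReal.ofReal σ * μ W) +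
        ENNReal.ofReal α * μ (S \ {x | ⟪e, x⟫_ℝ ≤ c}) := by ring
    _ ≤ _ := add_le_add hleft hright

/-- The cap contains a cone over the section by the cutting hyperplane. -/
theorem volume_cap_ge {K : Set E} (hK : Convex ℝ K) (hKc : IsCompact K) {n x₁ : E} (hn : ‖n‖ = 1)
    {h M : ℝ} (hM : 0 < M)
    (hx₁ : x₁ ∈ K) (hx₁h : h + M ≤ ⟪n, x₁⟫_ℝ) :
    ENNReal.ofReal (M / 2 ^ finrank ℝ E) * μHE[finrank ℝ E - 1] (K ∩ {x | ⟪n, x⟫_ℝ = h}) ≤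
      volume (K ∩ {x | h < ⟪n, x⟫_ℝ}) := by
  have hn0 : n ≠ 0 := by rintro rfl; simp at hn
  have : Nontrivial E := ⟨n, 0, hn0⟩
  have hpos : 0 < finrank ℝ E := finrank_pos
  have hmeas : MeasurableSet (K ∩ {x | h < ⟪n, x⟫_ℝ}) :=
    hKc.measurableSet.inter (isOpen_lt continuous_const (by fun_prop)).measurableSet
  rw [volume_eq_lintegral_slice hn hmeas]
  set μ : Measure E := μHE[finrank ℝ E - 1] with hμ
  have hslice (c : ℝ) (hc : c ∈ Ioc h (h + M / 2)) :
      ENNReal.ofReal ((1 / 2) ^ (finrank ℝ E - 1)) * μ (K ∩ {x | ⟪n, x⟫_ℝ = h}) ≤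
        μ (K ∩ {x | h < ⟪n, x⟫_ℝ} ∩ {x | ⟪n, x⟫_ℝ = c}) := by
    obtain ⟨hc1, hc2⟩ := hc
    set L := ⟪n, x₁⟫_ℝ - h
    have hL : 0 < L := sub_pos.2 ((lt_add_of_pos_right h hM).trans_le hx₁h)
    set r := 1 - (c - h) / L with hr
    have hr2 : 1 / 2 ≤ r := by
      have : (c - h) / L ≤ 1 / 2 := by
        rw [div_le_iff₀ hL]
        simp only [L]; linarith
      linarith
    have hr1 : r ≤ 1 := by
      have : 0 ≤ (c - h) / L := div_nonneg (by linarith) hL.le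
      linarith
    -- Shrinking the base towards the apex `x₁` by the ratio `r` lands at height `c`. Below half the
    -- depth `r ≥ 1/2`, so the area drops by at most `2 ^ (N - 1)`, with `N = finrank ℝ E`;
    -- integrating over a length `M / 2` gives the factor `M / 2 ^ N`.
    have hsub : AffineMap.homothety x₁ r '' (K ∩ {x | ⟪n, x⟫_ℝ = h}) ⊆
        K ∩ {x | h < ⟪n, x⟫_ℝ} ∩ {x | ⟪n, x⟫_ℝ = c} := by
      rintro _ ⟨p, ⟨hpK, hpn⟩, rfl⟩
      have hval : AffineMap.homothety x₁ r p = r • p + (1 - r) • x₁ := by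
        rw [AffineMap.homothety_apply, vsub_eq_sub, vadd_eq_add]
        module
      have hnc : ⟪n, AffineMap.homothety x₁ r p⟫_ℝ = c := by
        simp only [mem_ofPred_eq] at hpn
        rw [hval, inner_add_right, inner_smul_right, inner_smul_right, hpn,
          show ⟪n, x₁⟫_ℝ = h + L by simp [L]]
        have : (1 - r) * L = c - h := by
          rw [hr]; field_simp; ring
        linarith
      refine ⟨⟨?_, ?_⟩, hnc⟩
      · rw [hval]
        exact hK hpK hx₁ (by linarith) (by linarith) (by ring)
      · simp only [mem_ofPred_eq]
        rw [hnc]; exact hc1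
    refine le_trans ?_ (measure_mono hsub)
    rw [hμ, euclideanHausdorffMeasure_homothety_image _ _ (by linarith), ENNReal.smul_def,
      smul_eq_mul]
    gcongr
    rw [ENNReal.coe_pow, ← enorm_eq_nnnorm, ← ofReal_norm, ← ENNReal.ofReal_pow (norm_nonneg _)]
    refine ENNReal.ofReal_le_ofReal (pow_le_pow_left₀ (by norm_num) ?_ _)
    rw [Real.norm_eq_abs]
    exact hr2.trans (le_abs_self r)
  calc ENNReal.ofReal (M / 2 ^ finrank ℝ E) * μ (K ∩ {x | ⟪n, x⟫_ℝ = h})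
      = ENNReal.ofReal ((1 / 2) ^ (finrank ℝ E - 1)) * μ (K ∩ {x | ⟪n, x⟫_ℝ = h}) *
          volume (Ioc h (h + M / 2)) := by
        rw [Real.volume_Ioc, mul_right_comm, ← ENNReal.ofReal_mul (by positivity)]
        congr 2
        obtain ⟨k, hk⟩ := Nat.exists_eq_succ_of_ne_zero hpos.ne'
        rw [hk, Nat.succ_sub_one, pow_succ, one_div_pow]
        field_simp
        ring
    _ = ∫⁻ _ in Ioc h (h + M / 2),
          ENNReal.ofReal ((1 / 2) ^ (finrank ℝ E - 1)) * μ (K ∩ {x | ⟪n, x⟫_ℝ = h}) := by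
        rw [setLIntegral_const]
    _ ≤ ∫⁻ c in Ioc h (h + M / 2), μ (K ∩ {x | h < ⟪n, x⟫_ℝ} ∩ {x | ⟪n, x⟫_ℝ = c}) :=
        setLIntegral_mono' measurableSet_Ioc hslice
    _ ≤ _ := setLIntegral_le_lintegral _ _

/-- Some slice is at least comparable to the average `volume U / w`. The factor `2` leaves room: if
all slices were smaller, integrating would give `volume U ≤ volume U / 2`. -/
theorem exists_slice_ge {U : Set E} (hU : MeasurableSet U) (hU0 : volume U ≠ 0)
    (hUt : volume U ≠ ⊤) {e : E} (he : ‖e‖ = 1) {l w : ℝ} (hw : 0 < w)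
    (hUw : ∀ x ∈ U, ⟪e, x⟫_ℝ ∈ Icc l (l + w)) :
    ∃ c, volume U ≤ ENNReal.ofReal (2 * w) *
      μHE[finrank ℝ E - 1] (U ∩ {x | ⟪e, x⟫_ℝ = c}) := by
  by_contra! hcon
  have hw2 : ENNReal.ofReal (2 * w) ≠ 0 := by simpa using hw
  have h1 (c : ℝ) : μHE[finrank ℝ E - 1] (U ∩ {x | ⟪e, x⟫_ℝ = c}) ≤
      (Icc l (l + w)).indicator (fun _ => volume U / ENNReal.ofReal (2 * w)) c := by
    by_cases hc : c ∈ Icc l (l + w)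
    · rw [indicator_of_mem hc, ENNReal.le_div_iff_mul_le (Or.inl hw2) (Or.inl ENNReal.ofReal_ne_top),
        mul_comm]
      exact (hcon c).le
    · have : U ∩ {x | ⟪e, x⟫_ℝ = c} = ∅ := by
        rw [eq_empty_iff_forall_notMem]
        rintro x ⟨hx, rfl⟩
        exact hc (hUw x hx)
      simp [this]
  have h2 : volume U ≤ volume U / 2 := by
    calc volume U = ∫⁻ c, μHE[finrank ℝ E - 1] (U ∩ {x | ⟪e, x⟫_ℝ = c}) :=
          volume_eq_lintegral_slice he hU
      _ ≤ ∫⁻ c, (Icc l (l + w)).indicator (fun _ => volume U / ENNReal.ofReal (2 * w)) c :=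
          lintegral_mono h1
      _ = volume U / ENNReal.ofReal (2 * w) * ENNReal.ofReal w := by
          rw [lintegral_indicator measurableSet_Icc, setLIntegral_const, Real.volume_Icc,
            add_sub_cancel_left]
      _ = volume U / 2 := by
          rw [ENNReal.ofReal_mul (by norm_num), ENNReal.ofReal_ofNat, div_eq_mul_inv,
            ENNReal.mul_inv (by simp) (by simp), div_eq_mul_inv, mul_assoc, mul_assoc,
            ENNReal.inv_mul_cancel (by simpa using hw) ENNReal.ofReal_ne_top, mul_one]
  exact absurd h2 (not_le.2 (ENNReal.half_lt_self hU0 hUt))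

end ConvexGeometry

/-! ### Cutting off a cap: depth against width. -/

section Cut

variable {E : Type*} [NormedAddCommGroup E] [InnerProductSpace ℝ E]

theorem diff_inter_halfspace (K : Set E) (n : E) (h : ℝ) :
    K \ (K ∩ {x | ⟪n, x⟫_ℝ ≤ h}) = K ∩ {x | h < ⟪n, x⟫_ℝ} := by
  ext x
  simp only [mem_sdiff, mem_inter_iff, mem_ofPred_eq, not_and, not_le]
  exact ⟨fun hx => ⟨hx.1, hx.2 hx.1⟩, fun hx => ⟨hx.1, fun _ => hx.2⟩⟩

/-- Bounds the perimeter after the cut: the boundary of the cap is replaced by the flat section. -/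
theorem frontier_inter_halfspace_subset {K : Set E} (hK : IsClosed K) (n : E) (h : ℝ) :
    frontier (K ∩ {x | ⟪n, x⟫_ℝ ≤ h}) ⊆
      (frontier K \ {x | h ≤ ⟪n, x⟫_ℝ}) ∪ (K ∩ {x | ⟪n, x⟫_ℝ = h}) := by
  intro x hx
  have hcl : IsClosed {x : E | ⟪n, x⟫_ℝ ≤ h} := isClosed_le (by fun_prop) continuous_const
  have hxK := (hK.inter hcl).frontier_subset hx
  rcases (show ⟪n, x⟫_ℝ ≤ h from hxK.2).eq_or_lt with heq | hlt
  · exact Or.inr ⟨hxK.1, heq⟩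
  · refine Or.inl ⟨?_, not_le.2 hlt⟩
    rw [hK.frontier_eq]
    refine ⟨hxK.1, fun hint => hx.2 ?_⟩
    rw [interior_inter]
    refine ⟨hint, mem_interior.2 ⟨{x | ⟪n, x⟫_ℝ < h}, fun y (hy : ⟪n, y⟫_ℝ < h) => hy.le, ?_, hlt⟩⟩
    exact isOpen_lt (by fun_prop) continuous_const

variable [FiniteDimensional ℝ E] [MeasurableSpace E] [BorelSpace E]

/-- If cutting a convex body by a halfspace decreases the perimeter by at most `Λ` times the lost
volume, then the depth of the removed cap is controlled by the square of its width in any direction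
parallel to the cut. -/
theorem cap_depth_le {K : Set E} (hK : Convex ℝ K) (hKc : IsCompact K)
    (hint : (interior K).Nonempty) {n e : E} (hn : ‖n‖ = 1) (he : ‖e‖ = 1) (hne : ⟪n, e⟫_ℝ = 0)
    {h l w M Λ : ℝ} (hM : 0 < M) (hMw : M ≤ w) {x₁ : E} (hx₁ : x₁ ∈ K)
    (hx₁h : h + M ≤ ⟪n, x₁⟫_ℝ) (hwidth : ∀ x ∈ K, h < ⟪n, x⟫_ℝ → ⟪e, x⟫_ℝ ∈ Icc l (l + w))
    (hcut : (μHE[finrank ℝ E - 1] : Measure E).real (frontier K) ≤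
      (μHE[finrank ℝ E - 1] : Measure E).real (frontier (K ∩ {x | ⟪n, x⟫_ℝ ≤ h})) +
        Λ * (volume : Measure E).real (K \ (K ∩ {x | ⟪n, x⟫_ℝ ≤ h}))) :
    M ≤ 2 ^ (finrank ℝ E + 4) * Λ * w ^ 2 := by
  rw [diff_inter_halfspace] at hcut
  set N := finrank ℝ E
  have hw : 0 < w := hM.trans_le hMw
  have hP := euclideanHausdorffMeasure_frontier_lt_top hK hKc hint
  have hVt : volume (K ∩ {x | h < ⟪n, x⟫_ℝ}) ≠ ⊤ :=
    ((measure_mono inter_subset_left).trans_lt hKc.measure_lt_top).ne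
  have hopen : IsOpen {x : E | h < ⟪n, x⟫_ℝ} := isOpen_lt continuous_const (by fun_prop)
  have hV0 : volume (K ∩ {x | h < ⟪n, x⟫_ℝ}) ≠ 0 := by
    have hne' : (interior K ∩ {x | h < ⟪n, x⟫_ℝ}).Nonempty := by
      have hcl : x₁ ∈ closure (interior K) := by
        rw [hK.closure_interior_eq_closure_of_nonempty_interior hint]
        exact subset_closure hx₁
      obtain ⟨y, hy1, hy2⟩ := mem_closure_iff.1 hcl _ hopen
        (show h < ⟪n, x₁⟫_ℝ by linarith)
      exact ⟨y, hy2, hy1⟩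
    have hpos := (isOpen_interior.inter hopen).measure_pos volume hne'
    exact (hpos.trans_le (measure_mono (inter_subset_inter_left _ interior_subset))).ne'
  have hS : μHE[N - 1] (K ∩ {x | ⟪n, x⟫_ℝ = h}) < ⊤ :=
    euclideanHausdorffMeasure_slice_lt_top hn inter_subset_right
      (hKc.isBounded.subset inter_subset_left)
  have hmeas : MeasurableSet (K ∩ {x | h < ⟪n, x⟫_ℝ}) :=
    hKc.measurableSet.inter hopen.measurableSet
  obtain ⟨c, hc⟩ := exists_slice_ge hmeas hV0 hVt he hw (fun x hx => hwidth x hx.1 hx.2)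
  have hW : μHE[N - 1] (K ∩ {x | h < ⟪n, x⟫_ℝ} ∩ {x | ⟪e, x⟫_ℝ = c}) < ⊤ :=
    euclideanHausdorffMeasure_slice_lt_top he inter_subset_right
      (hKc.isBounded.subset (inter_subset_left.trans inter_subset_left))
  have hcone := volume_cap_ge hK hKc hn hM hx₁ hx₁h
  -- Chosen so that the error `σ² s` is at most half of the gain `σ W` once both are compared with
  -- `V`. The assumption `M ≤ w` keeps `σ` below `1/4`.
  set σ : ℝ := M / (w * 2 ^ (N + 2)) with hσ
  have hσ0 : 0 < σ := by positivity
  have hσ1 : σ ≤ 1 / 4 := by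
    rw [hσ, div_le_div_iff₀ (by positivity) (by norm_num), pow_add]
    have : (1 : ℝ) ≤ 2 ^ N := one_le_pow₀ (by norm_num)
    nlinarith
  have hσσ : 0 < 1 - σ ^ 2 := by nlinarith
  have harea := le_euclideanHausdorffMeasure_frontier_cap hKc hn he hne
    (Real.sqrt_pos.2 hσσ) hσ0 (by rw [Real.sq_sqrt hσσ.le]; ring) h c
  set α := √(1 - σ ^ 2) with hα
  have hα1 : 1 - σ ^ 2 ≤ α := by
    rw [hα]
    apply Real.le_sqrt_of_sq_le
    nlinarith [sq_nonneg σ]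
  -- pass to real numbers
  set μ : Measure E := μHE[N - 1]
  have hfr1 : μ (frontier K ∩ {x | h ≤ ⟪n, x⟫_ℝ}) ≠ ⊤ :=
    ((measure_mono inter_subset_left).trans_lt hP).ne
  have hfr2 : μ (frontier K \ {x | h ≤ ⟪n, x⟫_ℝ}) ≠ ⊤ :=
    ((measure_mono sdiff_subset).trans_lt hP).ne
  have hsplit : μ.real (frontier K) =
      μ.real (frontier K ∩ {x | h ≤ ⟪n, x⟫_ℝ}) + μ.real (frontier K \ {x | h ≤ ⟪n, x⟫_ℝ}) :=
    (measureReal_inter_add_sdiff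
      (isClosed_le continuous_const (by fun_prop)).measurableSet hP.ne).symm
  have hcutle : μ.real (frontier (K ∩ {x | ⟪n, x⟫_ℝ ≤ h})) ≤
      μ.real (frontier K \ {x | h ≤ ⟪n, x⟫_ℝ}) + μ.real (K ∩ {x | ⟪n, x⟫_ℝ = h}) :=
    (measureReal_mono (frontier_inter_halfspace_subset hKc.isClosed n h)
      ((measure_union_le _ _).trans_lt
        (ENNReal.add_lt_top.2 ⟨hfr2.lt_top, hS⟩)).ne).trans (measureReal_union_le _ _)
  have harea' : α * μ.real (K ∩ {x | ⟪n, x⟫_ℝ = h}) +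
      σ * μ.real (K ∩ {x | h < ⟪n, x⟫_ℝ} ∩ {x | ⟪e, x⟫_ℝ = c}) ≤
      μ.real (frontier K ∩ {x | h ≤ ⟪n, x⟫_ℝ}) := by
    have := ENNReal.toReal_mono hfr1 harea
    rwa [ENNReal.toReal_add (ENNReal.mul_ne_top ENNReal.ofReal_ne_top hS.ne)
      (ENNReal.mul_ne_top ENNReal.ofReal_ne_top hW.ne), ENNReal.toReal_mul, ENNReal.toReal_mul,
      ENNReal.toReal_ofReal (Real.sqrt_nonneg _), ENNReal.toReal_ofReal hσ0.le] at this
  have hcone' : M / 2 ^ N * μ.real (K ∩ {x | ⟪n, x⟫_ℝ = h}) ≤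
      (volume : Measure E).real (K ∩ {x | h < ⟪n, x⟫_ℝ}) := by
    have := ENNReal.toReal_mono hVt hcone
    rwa [ENNReal.toReal_mul, ENNReal.toReal_ofReal (by positivity)] at this
  have hc' : (volume : Measure E).real (K ∩ {x | h < ⟪n, x⟫_ℝ}) ≤
      2 * w * μ.real (K ∩ {x | h < ⟪n, x⟫_ℝ} ∩ {x | ⟪e, x⟫_ℝ = c}) := by
    have := ENNReal.toReal_mono (ENNReal.mul_ne_top ENNReal.ofReal_ne_top hW.ne) hc
    rwa [ENNReal.toReal_mul, ENNReal.toReal_ofReal (by positivity)] at this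
  have hVpos : 0 < (volume : Measure E).real (K ∩ {x | h < ⟪n, x⟫_ℝ}) :=
    ENNReal.toReal_pos hV0 hVt
  set V := (volume : Measure E).real (K ∩ {x | h < ⟪n, x⟫_ℝ})
  set s := μ.real (K ∩ {x | ⟪n, x⟫_ℝ = h})
  set W := μ.real (K ∩ {x | h < ⟪n, x⟫_ℝ} ∩ {x | ⟪e, x⟫_ℝ = c})
  have hs0 : 0 ≤ s := measureReal_nonneg
  -- The cap's boundary has area at least `α s + σ W` and, by the cut hypothesis, at most `s + Λ V`;
  -- moreover `1 - α ≤ σ²`.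
  have h1 : σ * W ≤ σ ^ 2 * s + Λ * V := by nlinarith
  have h2 : s ≤ 2 ^ N / M * V := by
    rw [div_mul_eq_mul_div, le_div_iff₀ hM]
    rw [div_mul_eq_mul_div, div_le_iff₀ (by positivity)] at hcone'
    linarith
  have h3 : V / (2 * w) ≤ W := by
    rw [div_le_iff₀ (by positivity)]
    linarith
  have h4 : σ * (V / (2 * w)) ≤ σ ^ 2 * (2 ^ N / M * V) + Λ * V :=
    (mul_le_mul_of_nonneg_left h3 hσ0.le).trans
      (h1.trans (add_le_add_left (mul_le_mul_of_nonneg_left h2 (sq_nonneg σ)) _))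
  have h5 : M / (2 ^ (N + 4) * w ^ 2) * V ≤ Λ * V := by
    have e1 : σ * (V / (2 * w)) = 2 * (M / (2 ^ (N + 4) * w ^ 2) * V) := by
      rw [hσ, pow_add, pow_add]
      field_simp
    have e2 : σ ^ 2 * (2 ^ N / M * V) = M / (2 ^ (N + 4) * w ^ 2) * V := by
      rw [hσ, pow_add, pow_add]
      field_simp
    linarith
  have h6 := le_of_mul_le_mul_right h5 hVpos
  rw [div_le_iff₀ (by positivity)] at h6
  linarith

end Cut

/-! ### Lipschitz regularity of the normal of a quasi-minimizer. -/

namespace SolidConvexBody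

variable {N : ℕ}

theorem exists_closedBall_subset (K : SolidConvexBody N) :
    ∃ a, ∃ ρ > 0, Metric.closedBall a ρ ⊆ K.carrier := by
  obtain ⟨a, ha⟩ := K.interior_nonempty'
  obtain ⟨ρ, hρ, h⟩ := Metric.nhds_basis_closedBall.mem_iff.1 (mem_interior_iff_mem_nhds.1 ha)
  exact ⟨a, ρ, hρ, h⟩

/-- The intersection of a convex body with a halfspace containing an interior point. -/
def cut (K : SolidConvexBody N) (n : EuclideanSpace ℝ (Fin N)) (h : ℝ)
    (hK : ∃ a ∈ interior K.carrier, ⟪n, a⟫_ℝ < h) : SolidConvexBody N where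
  carrier := K.carrier ∩ {x | ⟪n, x⟫_ℝ ≤ h}
  convex' := K.convex'.inter (convex_halfSpace_le (innerₛₗ ℝ n).isLinear h)
  isCompact' := K.isCompact'.inter_right (isClosed_le (by fun_prop) continuous_const)
  nonempty' := let ⟨a, ha, hah⟩ := hK; ⟨a, interior_subset ha, hah.le⟩
  interior_nonempty' := by
    obtain ⟨a, ha, hah⟩ := hK
    refine ⟨a, mem_interior.2 ⟨interior K.carrier ∩ {x | ⟪n, x⟫_ℝ < h}, ?_, ?_, ha, hah⟩⟩
    · exact inter_subset_inter interior_subset fun x (hx : ⟪n, x⟫_ℝ < h) => hx.le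
    · exact isOpen_interior.inter (isOpen_lt (by fun_prop) continuous_const)

/-- Bernoulli's inequality for `(1 - s) ^ N`. It certifies that a shallow cut is an admissible
competitor, losing volume at most `ε`. -/
theorem volDiff_le_of_homothety_subset (K K' : SolidConvexBody N)
    (hKK : K'.carrier ⊆ K.carrier) {a : EuclideanSpace ℝ (Fin N)} {s : ℝ} (hs : s ≤ 1)
    (h : AffineMap.homothety a (1 - s) '' K.carrier ⊆ K'.carrier) :
    volDiff K K' ≤ N * s * (volume : Measure (EuclideanSpace ℝ (Fin N))).real K.carrier := by
  have hd : volDiff K K' = (volume : Measure (EuclideanSpace ℝ (Fin N))).real K.carrier -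
      (volume : Measure (EuclideanSpace ℝ (Fin N))).real K'.carrier :=
    measureReal_sdiff hKK K'.isCompact'.measurableSet K.isCompact'.measure_lt_top.ne
  have hh : (1 - s) ^ N * (volume : Measure (EuclideanSpace ℝ (Fin N))).real K.carrier ≤
      (volume : Measure (EuclideanSpace ℝ (Fin N))).real K'.carrier := by
    have := measureReal_mono (μ := volume) h K'.isCompact'.measure_lt_top.ne
    rwa [measureReal_def, Measure.addHaar_image_homothety, ENNReal.toReal_mul,
      ENNReal.toReal_ofReal (abs_nonneg _), finrank_euclideanSpace_fin, abs_of_nonneg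
      (pow_nonneg (by linarith) _)] at this
  have hb : 1 + N * (-s) ≤ (1 - s) ^ N := by
    have := one_add_mul_le_pow (a := -s) (by linarith) N
    rwa [← sub_eq_add_neg] at this
  have h0 : 0 ≤ (volume : Measure (EuclideanSpace ℝ (Fin N))).real K.carrier := measureReal_nonneg
  rw [hd]
  nlinarith [mul_le_mul_of_nonneg_right hb h0]

/-- The outer normal of a quasi-minimizer is a Lipschitz function of the boundary point. -/
theorem IsQuasiMinimizer.exists_normal_lipschitz {K : SolidConvexBody N}
    (hK : K.IsQuasiMinimizer) : ∃ C ≥ (0 : ℝ), ∃ r > (0 : ℝ), ∀ x ∈ K.carrier, ∀ z ∈ K.carrier,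
      ∀ n m : EuclideanSpace ℝ (Fin N), ‖n‖ = 1 → ‖m‖ = 1 →
      (∀ p ∈ K.carrier, ⟪n, p⟫_ℝ ≤ ⟪n, x⟫_ℝ) → (∀ p ∈ K.carrier, ⟪m, p⟫_ℝ ≤ ⟪m, z⟫_ℝ) →
      ∀ δ : ℝ, 0 < δ → δ ≤ r → ‖x - z‖ ≤ δ → ‖n - m‖ ≤ C * δ := by
  obtain ⟨ε, hε, Λ, hΛ, hq⟩ := hK
  obtain ⟨a, ρ, hρ, hball⟩ := K.exists_closedBall_subset
  set V := (volume : Measure (EuclideanSpace ℝ (Fin N))).real K.carrier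
  have hV : 0 ≤ V := measureReal_nonneg
  -- The exponent comes from depth `D δ / 2` and width `4 δ` in `cap_depth_le`: `2 · 4² · 2 ^ (N +
  -- 4)`. The bound `ρ / 4` excludes `n = -m` and keeps `a` below the cut; the other bound makes the
  -- lost volume at most `ε`.
  refine ⟨2 ^ (N + 9) * Λ, by positivity, min (ρ / 4) (ε * ρ / (2 * N * V + 1)), by positivity, ?_⟩
  intro x hx z hz n m hn hm hnx hmz δ hδ hδr hxz
  have hδ1 : δ ≤ ρ / 4 := hδr.trans (min_le_left _ _)
  have hδ2 : δ * (2 * N * V + 1) ≤ ε * ρ :=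
    (le_div_iff₀ (by positivity)).1 (hδr.trans (min_le_right _ _))
  rcases eq_or_ne n m with rfl | hnm
  · rw [sub_self, norm_zero]; positivity
  set D := ‖n - m‖ with hD
  have hD0 : 0 < D := norm_pos_iff.2 (sub_ne_zero.2 hnm)
  have hD2 : D ≤ 2 := (norm_sub_le n m).trans (by rw [hn, hm]; norm_num)
  set q := n + m with hqdef
  have hq2 : ‖q‖ ≤ 2 := (norm_add_le n m).trans (by rw [hn, hm]; norm_num)
  set H := ⟪n, x⟫_ℝ + ⟪m, z⟫_ℝ with hH
  have hqK (p) (hp : p ∈ K.carrier) : ⟪q, p⟫_ℝ ≤ H := by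
    rw [hqdef, inner_add_left]
    exact add_le_add (hnx p hp) (hmz p hp)
  have hqa : ⟪q, a⟫_ℝ + 2 * ρ ≤ H := by
    have h1 := inner_add_radius_le hn hρ.le hball hnx
    have h2 := inner_add_radius_le hm hρ.le hball hmz
    rw [hqdef, inner_add_left]
    linarith
  -- As `n` supports `K` at `x`, only `m - n` contributes: the gain is of order `D δ` rather than
  -- `δ`, so `x` is almost extremal for `m` too.
  have hmxz : ⟪m, z - x⟫_ℝ ≤ D * δ := by
    have h1 : ⟪n, z - x⟫_ℝ ≤ 0 := by rw [inner_sub_right]; linarith [hnx z hz]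
    have h2 : ⟪m - n, z - x⟫_ℝ ≤ ‖m - n‖ * ‖z - x‖ := real_inner_le_norm _ _
    rw [norm_sub_rev m n, norm_sub_rev z x, inner_sub_left] at h2
    have h3 : D * ‖x - z‖ ≤ D * δ := mul_le_mul_of_nonneg_left hxz hD0.le
    linarith
  have hq0 : 0 < ‖q‖ := by
    rw [norm_pos_iff]
    intro h0
    have hmn : n = -m := eq_neg_of_add_eq_zero_left h0
    have : H = ⟪m, z - x⟫_ℝ := by
      rw [hH, hmn, inner_neg_left, inner_sub_right]; ring
    rw [h0, inner_zero_left] at hqa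
    nlinarith
  -- `⟪q, ·⟫` is at most `H` on `K` and at least `H - D δ` at `x`, so this level leaves `x` at depth
  -- `D δ` before dividing by `‖q‖ ≤ 2`.
  set h := H - 2 * D * δ with hh
  set n' := ‖q‖⁻¹ • q with hn'
  set e := D⁻¹ • (n - m) with he
  have hn'1 : ‖n'‖ = 1 := norm_smul_inv_norm (norm_pos_iff.1 hq0)
  have he1 : ‖e‖ = 1 := norm_smul_inv_norm (norm_pos_iff.1 hD0)
  have horth : ⟪n', e⟫_ℝ = 0 := by
    rw [hn', he, inner_smul_left, inner_smul_right, hqdef, inner_add_left, inner_sub_right,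
      inner_sub_right, real_inner_self_eq_norm_sq, real_inner_self_eq_norm_sq, hn, hm,
      real_inner_comm]
    simp
  have hin (p : EuclideanSpace ℝ (Fin N)) : ⟪n', p⟫_ℝ = ⟪q, p⟫_ℝ / ‖q‖ := by
    rw [hn', inner_smul_left, div_eq_inv_mul]; simp
  have hie (p : EuclideanSpace ℝ (Fin N)) : ⟪e, p⟫_ℝ = (⟪n, p⟫_ℝ - ⟪m, p⟫_ℝ) / D := by
    rw [he, inner_smul_left, div_eq_inv_mul, inner_sub_left]; simp
  have hah : ⟪q, a⟫_ℝ < h := by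
    rw [hh]; nlinarith
  have hcut : ∃ a ∈ interior K.carrier, ⟪n', a⟫_ℝ < h / ‖q‖ := by
    refine ⟨a, mem_interior_iff_mem_nhds.2 (Filter.mem_of_superset
      (Metric.closedBall_mem_nhds a hρ) hball), ?_⟩
    rw [hin]
    exact div_lt_div_of_pos_right hah hq0
  have hsub : (K.cut n' (h / ‖q‖) hcut).carrier ⊆ K.carrier := inter_subset_left
  have hvol : volDiff K (K.cut n' (h / ‖q‖) hcut) ≤ ε := by
    -- Contracting towards `a` by `1 - 2 δ / ρ` lowers the bound on `⟪q, ·⟫` by `4 δ ≥ 2 D δ`, as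
    -- `a` lies `2 ρ` below `H`; the contracted body survives the cut.
    have hs1 : 2 * δ / ρ ≤ 1 := by rw [div_le_one hρ]; linarith
    refine (volDiff_le_of_homothety_subset K _ hsub (a := a) (s := 2 * δ / ρ) hs1 ?_).trans ?_
    · rintro _ ⟨p, hp, rfl⟩
      have hs0 : 0 ≤ 2 * δ / ρ := by positivity
      have hval : AffineMap.homothety a (1 - 2 * δ / ρ) p =
          (1 - 2 * δ / ρ) • p + (2 * δ / ρ) • a := by
        rw [AffineMap.homothety_apply, vsub_eq_sub, vadd_eq_add]
        module
      refine ⟨?_, ?_⟩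
      · rw [hval]
        exact K.convex' hp (hball (Metric.mem_closedBall_self hρ.le)) (by linarith) hs0 (by ring)
      · rw [mem_ofPred_eq, hin, hval, inner_add_right, inner_smul_right, inner_smul_right]
        refine div_le_div_of_nonneg_right ?_ hq0.le
        have h1 := mul_le_mul_of_nonneg_left (hqK p hp) (show 0 ≤ 1 - 2 * δ / ρ by linarith)
        have h2 := mul_le_mul_of_nonneg_left hqa hs0
        have h3 : 2 * δ / ρ * (2 * ρ) = 4 * δ := by field_simp; ring
        rw [hh]
        nlinarith
    · have : N * (2 * δ / ρ) * V = δ * (2 * N * V) / ρ := by ring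
      rw [this, div_le_iff₀ hρ]
      linarith
  have hper := hq _ hsub hvol
  have hfin : finrank ℝ (EuclideanSpace ℝ (Fin N)) = N := finrank_euclideanSpace_fin
  have hdepth := cap_depth_le (l := (h - 2 * ⟪m, z⟫_ℝ) / D) (w := 4 * δ) (M := D * δ / 2) (Λ := Λ)
    K.convex' K.isCompact' K.interior_nonempty' hn'1 he1 horth (by positivity) (by nlinarith) hx
    (h := h / ‖q‖) ?_ ?_ (by rw [hfin]; exact hper)
  · rw [hfin] at hdepth
    have h9 : (2 : ℝ) ^ (N + 9) = 32 * 2 ^ (N + 4) := by rw [pow_add, pow_add]; ring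
    rw [h9]
    have : D * δ ≤ (32 * 2 ^ (N + 4) * Λ * δ) * δ := by nlinarith
    exact le_of_mul_le_mul_right this hδ
  · rw [hin, ← sub_nonneg]
    have h1 : h + D * δ ≤ ⟪q, x⟫_ℝ := by
      rw [inner_sub_right] at hmxz
      rw [hh, hH, hqdef, inner_add_left]
      linarith
    have h2 : D * δ / 2 * ‖q‖ ≤ D * δ := by nlinarith [mul_pos hD0 hδ]
    have : ⟪q, x⟫_ℝ / ‖q‖ - (h / ‖q‖ + D * δ / 2) = (⟪q, x⟫_ℝ - h - D * δ / 2 * ‖q‖) / ‖q‖ := by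
      field_simp
      ring
    rw [this]
    exact div_nonneg (by linarith) hq0.le
  -- In the cap the deficits of `⟪n, p⟫` and `⟪m, p⟫` from their maxima sum to less than `2 D δ`, so
  -- their difference varies by at most `4 D δ`; dividing by `D` gives width `4 δ`.
  · intro p hp hph
    rw [hin, div_lt_div_iff_of_pos_right hq0, hqdef, inner_add_left] at hph
    have h1 := hnx p hp
    have h2 := hmz p hp
    rw [hie]
    constructor
    · exact div_le_div_of_nonneg_right (by linarith) hD0.le
    · have : (h - 2 * ⟪m, z⟫_ℝ) / D + 4 * δ = (h - 2 * ⟪m, z⟫_ℝ + 4 * δ * D) / D := by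
        field_simp
      rw [this]
      refine div_le_div_of_nonneg_right ?_ hD0.le
      have : h = ⟪n, x⟫_ℝ + ⟪m, z⟫_ℝ - 2 * D * δ := hh
      linarith

end SolidConvexBody

/-! ### From Lipschitz normals to a `C^{1,1}` graph. -/

section Graph

variable {F : Type*} [NormedAddCommGroup F] [InnerProductSpace ℝ F]

/-- A function admitting a Lipschitz selection of subgradients is of class `C^{1,1}`. -/
theorem isC11On_ball_of_subgradient {u : F → ℝ} {g : F → F} {r : ℝ} {L : ℝ≥0}
    (hg : LipschitzOnWith L g (Metric.ball 0 r))
    (hu : ∀ y ∈ Metric.ball (0 : F) r, ∀ z ∈ Metric.ball (0 : F) r,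
      ⟪g y, z - y⟫_ℝ ≤ u z - u y) : IsC11On u (Metric.ball 0 r) := by
  have hder (y : F) (hy : y ∈ Metric.ball (0 : F) r) : HasFDerivAt u (innerSL ℝ (g y)) y := by
    -- The subgradient inequalities at `y` and at `z` place the remainder between `0` and `⟪g z - g
    -- y, z - y⟫ ≤ L ‖z - y‖²`.
    have hO : (fun z => u z - u y - ⟪g y, z - y⟫_ℝ) =O[nhds y] fun z => ‖z - y‖ ^ 2 := by
      refine Asymptotics.IsBigO.of_bound L ?_
      filter_upwards [Metric.isOpen_ball.mem_nhds hy] with z hz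
      have h1 := hu y hy z hz
      have h2 := hu z hz y hy
      have h3 : ⟪g z - g y, z - y⟫_ℝ ≤ L * ‖z - y‖ * ‖z - y‖ :=
        (real_inner_le_norm _ _).trans (mul_le_mul_of_nonneg_right
          (by simpa [dist_eq_norm] using hg.dist_le_mul z hz y hy) (norm_nonneg _))
      have h4 : ⟪g z, y - z⟫_ℝ = -⟪g z, z - y⟫_ℝ := by rw [← inner_neg_right, neg_sub]
      rw [inner_sub_left] at h3
      rw [Real.norm_of_nonneg (by linarith), Real.norm_of_nonneg (by positivity)]
      nlinarith
    have h0 := hO.hasFDerivAt (𝕜 := ℝ) (by norm_num)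
    have h1 : HasFDerivAt (fun z => ⟪g y, z - y⟫_ℝ) (innerSL ℝ (g y)) y := by
      have := (innerSL ℝ (g y)).hasFDerivAt.comp y ((hasFDerivAt_id y).sub_const y)
      simpa [Function.comp_def] using this
    have h2 := (h0.add h1).add_const (u y)
    rw [zero_add] at h2
    refine h2.congr_of_eventuallyEq (Filter.Eventually.of_forall fun z => ?_)
    simp
  have hlip : LipschitzOnWith L (fderiv ℝ u) (Metric.ball 0 r) := by
    refine LipschitzOnWith.of_dist_le_mul fun y hy z hz => ?_
    rw [(hder y hy).fderiv, (hder z hz).fderiv, dist_eq_norm, ← map_sub, innerSL_apply_norm,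
      ← dist_eq_norm]
    exact hg.dist_le_mul y hy z hz
  refine ⟨?_, L, hlip⟩
  rw [show (1 : WithTop ℕ∞) = 0 + 1 by simp,
    contDiffOn_succ_iff_fderiv_of_isOpen Metric.isOpen_ball]
  refine ⟨fun y hy => (hder y hy).differentiableAt.differentiableWithinAt, by simp, ?_⟩
  exact contDiffOn_zero.2 hlip.continuousOn

variable {E : Type*} [NormedAddCommGroup E] [InnerProductSpace ℝ E]

/-- Transfers the Lipschitz bound from normals to slopes: the slope is the tangential part of the
normal divided by its vertical part, which stays above `l⁻¹`. -/
theorem norm_inv_smul_orthogonalProjectionOnto_sub_le (U : Submodule ℝ E) [U.HasOrthogonalProjection] {n m : E}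
    (hm : ‖m‖ = 1) {a b l : ℝ} (ha : l⁻¹ ≤ a) (hb : l⁻¹ ≤ b) (hl : 0 < l)
    (hab : |a - b| ≤ ‖n - m‖) :
    ‖a⁻¹ • U.orthogonalProjectionOnto n - b⁻¹ • U.orthogonalProjectionOnto m‖ ≤
      (l + l ^ 2) * ‖n - m‖ := by
  have ha0 : 0 < a := (inv_pos.2 hl).trans_le ha
  have hb0 : 0 < b := (inv_pos.2 hl).trans_le hb
  have ha' : a⁻¹ ≤ l := inv_le_of_inv_le₀ hl ha
  have hb' : b⁻¹ ≤ l := inv_le_of_inv_le₀ hl hb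
  have hP (v : E) : ‖U.orthogonalProjectionOnto v‖ ≤ ‖v‖ := U.norm_orthogonalProjectionOnto_apply_le v
  have hsplit : a⁻¹ • U.orthogonalProjectionOnto n - b⁻¹ • U.orthogonalProjectionOnto m =
      a⁻¹ • U.orthogonalProjectionOnto (n - m) + (a⁻¹ - b⁻¹) • U.orthogonalProjectionOnto m := by
    rw [map_sub]
    module
  have hinv : |a⁻¹ - b⁻¹| ≤ l ^ 2 * ‖n - m‖ := by
    rw [inv_sub_inv ha0.ne' hb0.ne', abs_div, abs_sub_comm, abs_of_pos (mul_pos ha0 hb0),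
      div_eq_mul_inv, mul_comm, mul_inv, sq]
    gcongr
  rw [hsplit]
  refine (norm_add_le _ _).trans ?_
  rw [norm_smul, norm_smul, Real.norm_eq_abs, Real.norm_eq_abs, abs_of_pos (inv_pos.2 ha0), add_mul]
  refine add_le_add (mul_le_mul ha' (hP _) (norm_nonneg _) hl.le) ?_
  calc |a⁻¹ - b⁻¹| * ‖U.orthogonalProjectionOnto m‖ ≤ (l ^ 2 * ‖n - m‖) * 1 :=
        mul_le_mul hinv ((hP m).trans hm.le) (norm_nonneg _) (by positivity)
    _ = _ := mul_one _

/-- A convex body whose outer normal is locally a Lipschitz function of the boundary point is of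
class `C^{1,1}`. -/
theorem isC11Set_of_normal_lipschitz [CompleteSpace E] {K : Set E} (hK : Convex ℝ K)
    (hKc : IsCompact K) {a : E} {ρ : ℝ} (hρ : 0 < ρ) (hball : Metric.closedBall a ρ ⊆ K)
    {C r : ℝ} (hC : 0 ≤ C) (hr : 0 < r)
    (hlip : ∀ x ∈ K, ∀ z ∈ K, ∀ n m : E, ‖n‖ = 1 → ‖m‖ = 1 →
      (∀ p ∈ K, ⟪n, p⟫_ℝ ≤ ⟪n, x⟫_ℝ) → (∀ p ∈ K, ⟪m, p⟫_ℝ ≤ ⟪m, z⟫_ℝ) →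
      ∀ δ : ℝ, 0 < δ → δ ≤ r → ‖x - z‖ ≤ δ → ‖n - m‖ ≤ C * δ) : IsC11Set K := by
  intro x₀ hx₀
  have hint : (interior K).Nonempty := ⟨a, mem_interior_iff_mem_nhds.2
    (Filter.mem_of_superset (Metric.closedBall_mem_nhds a hρ) hball)⟩
  obtain ⟨R₀, hR₀⟩ := hKc.isBounded.subset_closedBall (0 : E)
  set R := max R₀ 1 with hR
  have hR0 : 0 < R := lt_of_lt_of_le one_pos (le_max_right _ _)
  have hKR (p) (hp : p ∈ K) : ‖p‖ ≤ R := by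
    have := hR₀ hp
    rw [mem_closedBall_zero_iff] at this
    exact this.trans (le_max_left _ _)
  set d := ‖a - x₀‖ with hd
  have hdρ : ρ ≤ d := by
    by_contra! hlt
    refine hx₀.2 (mem_interior.2 ⟨Metric.ball a ρ, Metric.ball_subset_closedBall.trans hball,
      Metric.isOpen_ball, ?_⟩)
    rwa [mem_ball_iff_norm, norm_sub_rev]
  have hd0 : 0 < d := hρ.trans_le hdρ
  -- The vertical axis points from `x₀` to the centre of an interior ball, so every vertical line
  -- near `x₀` meets `K` and the lower boundary is a graph.
  set ξ := d⁻¹ • (a - x₀) with hξ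
  have hξ1 : ‖ξ‖ = 1 := norm_smul_inv_norm (norm_pos_iff.1 hd0)
  have hξ0 : ξ ≠ 0 := by intro h0; simp [h0] at hξ1
  have ha : a = x₀ + d • ξ := by
    rw [hξ, smul_smul, mul_inv_cancel₀ hd0.ne', one_smul]; abel
  let F : Submodule ℝ E := (ℝ ∙ ξ)ᗮ
  let T (y : F) : Set ℝ := {t | x₀ + (y : E) + t • ξ ∈ K}
  let u (y : F) : ℝ := sInf (T y)
  have hemb (y : F) : Topology.IsClosedEmbedding (fun t : ℝ => x₀ + (y : E) + t • ξ) :=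
    (Homeomorph.addLeft _).isClosedEmbedding.comp (isClosedEmbedding_smul_left hξ0)
  have hTc (y : F) : IsCompact (T y) := (hemb y).isCompact_preimage hKc
  have haK (y : F) (hy : ‖y‖ ≤ ρ) : a + y ∈ K := hball (by simpa using hy)
  have hdT (y : F) (hy : ‖y‖ ≤ ρ) : d ∈ T y := by
    have := haK y hy
    rw [ha] at this
    change x₀ + (y : E) + d • ξ ∈ K
    rwa [add_right_comm]
  have hleast (y : F) (hy : ‖y‖ ≤ ρ) : IsLeast (T y) (u y) := (hTc y).isLeast_sInf ⟨d, hdT y hy⟩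
  have hud (y : F) (hy : ‖y‖ ≤ ρ) : u y ≤ d := (hleast y hy).2 (hdT y hy)
  let X (y : F) : E := x₀ + y + u y • ξ
  have hXK (y : F) (hy : ‖y‖ ≤ ρ) : X y ∈ K := (hleast y hy).1
  have hXint (y : F) (hy : ‖y‖ ≤ ρ) : X y ∉ interior K := by
    intro hmem
    have hnear : ∀ᶠ s in nhds (u y), s ∈ T y :=
      (hemb y).continuous.continuousAt.preimage_mem_nhds (mem_interior_iff_mem_nhds.1 hmem)
    obtain ⟨s, hs, hsu⟩ := (hnear.filter_mono nhdsWithin_le_nhds |>.and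
      (self_mem_nhdsWithin : Iio (u y) ∈ nhdsWithin (u y) (Iio (u y)))).exists
    exact absurd ((hleast y hy).2 hs) (not_le.2 hsu)
  have hex (y : F) (hy : ‖y‖ ≤ ρ) :
      ∃ n : E, ‖n‖ = 1 ∧ ∀ p ∈ K, ⟪n, p⟫_ℝ ≤ ⟪n, X y⟫_ℝ :=
    hK.exists_unit_normal hint (hXint y hy)
  choose! n hn1 hnK using hex
  set l := 4 * R / ρ with hl
  have hl0 : 0 < l := by positivity
  -- Normals are uniformly transversal to `ξ`: the ball of radius `ρ / 2` about `a + y` lies in `K`,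
  -- at height at most `2 R` above `X y`, so `ρ / 2 ≤ 2 R · (-⟪n y, ξ⟫)`.
  have hνl (y : F) (hy : ‖y‖ ≤ ρ / 2) : l⁻¹ ≤ -⟪n y, ξ⟫_ℝ := by
    have hyρ : ‖y‖ ≤ ρ := by linarith
    have hsub : Metric.closedBall (a + (y : E)) (ρ / 2) ⊆ K := by
      refine (Metric.closedBall_subset_closedBall' ?_).trans hball
      rw [dist_eq_norm, add_sub_cancel_left]
      change ρ / 2 + ‖y‖ ≤ ρ
      linarith
    have h1 := inner_add_radius_le (hn1 y hyρ) (by positivity) hsub (hnK y hyρ)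
    have hX : a + (y : E) = X y + (d - u y) • ξ := by
      rw [ha]; simp only [X]; module
    have h2 : ‖(d - u y) • ξ‖ ≤ 2 * R := by
      have : (d - u y) • ξ = (a + (y : E)) - X y := by rw [hX]; abel
      rw [this]
      refine (norm_sub_le _ _).trans ?_
      linarith [hKR _ (haK y hyρ), hKR _ (hXK y hyρ)]
    have h3 : 0 ≤ d - u y := sub_nonneg.2 (hud y hyρ)
    rw [norm_smul, hξ1, mul_one, Real.norm_of_nonneg h3] at h2
    rw [hX, inner_add_right, inner_smul_right] at h1
    have h4 : ρ / 2 ≤ (d - u y) * -⟪n y, ξ⟫_ℝ := by linarith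
    have h5 : 0 < -⟪n y, ξ⟫_ℝ := by
      by_contra! hcon
      nlinarith
    rw [hl, inv_div, div_le_iff₀ (by positivity)]
    nlinarith
  let g (y : F) : F := (-⟪n y, ξ⟫_ℝ)⁻¹ • F.orthogonalProjectionOnto (n y)
  have hsubgrad (y z : F) (hy : ‖y‖ ≤ ρ / 2) (hz : ‖z‖ ≤ ρ / 2) :
      ⟪g y, z - y⟫_ℝ ≤ u z - u y := by
    have h1 := hnK y (by linarith) _ (hXK z (by linarith))
    have h2 := hνl y hy
    have hν0 : 0 < -⟪n y, ξ⟫_ℝ := (inv_pos.2 hl0).trans_le h2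
    simp only [X, inner_add_right, inner_smul_right] at h1
    have h3 : ⟪g y, z - y⟫_ℝ = (-⟪n y, ξ⟫_ℝ)⁻¹ * ⟪n y, ((z - y : F) : E)⟫_ℝ := by
      simp only [g, inner_smul_left, conj_trivial]
      rw [F.inner_orthogonalProjectionOnto_eq_of_mem_right]
    rw [h3, inv_mul_le_iff₀ hν0, Submodule.coe_sub, inner_sub_right]
    linarith
  have hgl (y : F) (hy : ‖y‖ ≤ ρ / 2) : ‖g y‖ ≤ l := by
    have h2 := hνl y hy
    have hν0 : 0 < -⟪n y, ξ⟫_ℝ := (inv_pos.2 hl0).trans_le h2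
    simp only [g]
    rw [norm_smul, Real.norm_of_nonneg (inv_pos.2 hν0).le]
    have h3 : ‖F.orthogonalProjectionOnto (n y)‖ ≤ 1 :=
      (F.norm_orthogonalProjectionOnto_apply_le _).trans (hn1 y (by linarith)).le
    calc _ ≤ l * 1 := mul_le_mul (inv_le_of_inv_le₀ hl0 h2) h3 (norm_nonneg _) hl0.le
      _ = l := mul_one l
  have hulip (y z : F) (hy : ‖y‖ ≤ ρ / 2) (hz : ‖z‖ ≤ ρ / 2) : |u y - u z| ≤ l * ‖y - z‖ := by
    have key (y z : F) (hy : ‖y‖ ≤ ρ / 2) (hz : ‖z‖ ≤ ρ / 2) : u y - u z ≤ l * ‖y - z‖ := by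
      have h1 := hsubgrad y z hy hz
      have h2 : ⟪g y, y - z⟫_ℝ ≤ l * ‖y - z‖ :=
        (real_inner_le_norm _ _).trans (mul_le_mul_of_nonneg_right (hgl y hy) (norm_nonneg _))
      have h4 : ⟪g y, z - y⟫_ℝ = -⟪g y, y - z⟫_ℝ := by rw [← inner_neg_right, neg_sub]
      linarith
    rw [abs_le]
    have := key z y hz hy
    rw [norm_sub_rev] at this
    exact ⟨by linarith, key y z hy hz⟩
  -- The second bound ensures `‖X y - X z‖ ≤ (1 + l) ‖y - z‖ ≤ r`, within reach of `hlip`.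
  set r' := min (ρ / 2) (r / (2 * (1 + l))) with hr'
  have hr'0 : 0 < r' := by positivity
  have hin (y : F) (hy : y ∈ Metric.ball (0 : F) r') : ‖y‖ ≤ ρ / 2 :=
    (mem_ball_zero_iff.1 hy).le.trans (min_le_left _ _)
  have hnlip (y : F) (hy : y ∈ Metric.ball (0 : F) r') (z : F) (hz : z ∈ Metric.ball (0 : F) r') :
      ‖n y - n z‖ ≤ C * (1 + l) * ‖y - z‖ := by
    rcases eq_or_ne y z with rfl | hyz
    · simp
    have hyz0 : 0 < ‖y - z‖ := norm_pos_iff.2 (sub_ne_zero.2 hyz)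
    have hy2 := hin y hy
    have hz2 := hin z hz
    rw [mul_assoc]
    refine hlip (X y) (hXK y (by linarith)) (X z) (hXK z (by linarith)) _ _ (hn1 y (by linarith))
      (hn1 z (by linarith)) (hnK y (by linarith)) (hnK z (by linarith)) _ (by positivity) ?_ ?_
    · have h1 : ‖y - z‖ ≤ 2 * (r / (2 * (1 + l))) := by
        refine (norm_sub_le y z).trans ?_
        have h2 := (mem_ball_zero_iff.1 hy).le.trans (min_le_right _ _)
        have h3 := (mem_ball_zero_iff.1 hz).le.trans (min_le_right _ _)
        linarith
      calc (1 + l) * ‖y - z‖ ≤ (1 + l) * (2 * (r / (2 * (1 + l)))) := by gcongr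
        _ = r := by field_simp
    · have h1 : X y - X z = ((y - z : F) : E) + (u y - u z) • ξ := by
        simp only [X, Submodule.coe_sub]; module
      rw [h1, add_mul, one_mul]
      refine (norm_add_le _ _).trans (add_le_add (le_of_eq rfl) ?_)
      rw [norm_smul, hξ1, mul_one, Real.norm_eq_abs]
      exact hulip y z hy2 hz2
  have hglip : LipschitzOnWith (Real.toNNReal ((l + l ^ 2) * (C * (1 + l)))) g
      (Metric.ball 0 r') := by
    refine LipschitzOnWith.of_dist_le_mul fun y hy z hz => ?_
    rw [dist_eq_norm, dist_eq_norm, Real.coe_toNNReal _ (by positivity)]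
    have hy2 := hin y hy
    have hz2 := hin z hz
    have hν : |-⟪n y, ξ⟫_ℝ - -⟪n z, ξ⟫_ℝ| ≤ ‖n y - n z‖ := by
      have : -⟪n y, ξ⟫_ℝ - -⟪n z, ξ⟫_ℝ = -⟪n y - n z, ξ⟫_ℝ := by rw [inner_sub_left]; ring
      rw [this, abs_neg]
      simpa [hξ1] using abs_real_inner_le_norm (n y - n z) ξ
    refine (norm_inv_smul_orthogonalProjectionOnto_sub_le F (hn1 z (by linarith)) (hνl y hy2) (hνl z hz2) hl0
      hν).trans ?_
    rw [mul_assoc]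
    exact mul_le_mul_of_nonneg_left (hnlip y hy z hz) (by positivity)
  refine ⟨ξ, hξ1, r', hr'0, u, isC11On_ball_of_subgradient hglip
    (fun y hy z hz => hsubgrad y z (hin y hy) (hin z hz)), fun y hy t ht => ?_⟩
  have hyρ : ‖y‖ ≤ ρ := by linarith [hin y hy]
  refine ⟨fun h => (hleast y hyρ).2 h, fun h => ?_⟩
  -- Since `t < ρ / 2 < d`, the point lies between the lowest point of `K` on its vertical line and
  -- the one at height `d`, so convexity places it in `K`.
  have htd : t ≤ d := by
    have h1 : r' ≤ ρ / 2 := min_le_left _ _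
    have h2 := (abs_lt.1 ht).2
    linarith
  have hconv : Convex ℝ (T y) := by
    intro s hs t ht b c hb hc hbc
    have h1 := hK hs ht hb hc hbc
    change x₀ + (y : E) + (b • s + c • t) • ξ ∈ K
    convert h1 using 1
    have hc' : c = 1 - b := by linarith
    subst hc'
    simp only [smul_eq_mul]
    module
  exact hconv.ordConnected.out (hleast y hyρ).1 (hdT y hyρ) ⟨h, htd⟩

end Graph

/-! ### Conclusion for minimizers. -/

theorem SolidConvexBody.IsMinimizer.isQuasiMinimizer {N : ℕ} {R : SolidConvexBody N → ℝ}
    {D : Set (EuclideanSpace ℝ (Fin N))} {K : SolidConvexBody N} (hK : IsMinimizer R D K)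
    (hR : InnerLipschitz R) : K.IsQuasiMinimizer := by
  obtain ⟨C, hC, ε, hε, h⟩ := hR K
  refine ⟨ε, hε, C, hC.le, fun K' hsub hvol => ?_⟩
  linarith [h K' hsub hvol, hK.2 K' (hsub.trans hK.1)]

theorem SolidConvexBody.IsQuasiMinimizer.isC11Set {N : ℕ} {K : SolidConvexBody N}
    (hK : K.IsQuasiMinimizer) : IsC11Set K.carrier := by
  obtain ⟨a, ρ, hρ, hball⟩ := K.exists_closedBall_subset
  obtain ⟨C, hC, r, hr, hlip⟩ := hK.exists_normal_lipschitz
  exact isC11Set_of_normal_lipschitz K.convex' K.isCompact' hρ hball hC hr hlip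

theorem corollary2p3 (N : ℕ) (hN : 1 ≤ N) (D : Set (EuclideanSpace ℝ (Fin N)))
    (R : SolidConvexBody N → ℝ) (hR : SolidConvexBody.InnerLipschitz R)
    (K : SolidConvexBody N) (hK : SolidConvexBody.IsMinimizer R D K) :
    SolidConvexBody.IsQuasiMinimizer K ∧ IsC11Set K.carrier :=
  ⟨hK.isQuasiMinimizer hR, (hK.isQuasiMinimizer hR).isC11Set⟩
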